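/- Let $d\ge 0$, let $\mathcal X,\mathcal Y\subseteq\mathbb R^d$ be measurable, and let $f,g:\mathbb R^d\to\mathbb R$ be such that $e^{-f}$ on $\mathcal X$ and $e^{-g}$ on $\mathcal Y$ (both extended by $0$) are probability densities with respect to Lebesgue measure; the case $\mathcal X=\mathcal Y=\mathbb R^d$ is included. For $\epsilon>0$ define one Sinkhorn step by $$\mathcal V^{\epsilon}[\psi](y):=\epsilon\log\int_{\mathcal X}\frac{\exp\left(\frac1\epsilon\langle x,y\rangle\right)}{\int_{\mathcal Y}\exp\left(\frac1\epsilon\langle x,y'\rangle-\frac1\epsilon\psi(y')-g(y')\right)dy'}\,e^{-f(x)}\,dx .$$ Let $\psi:\mathbb R^d\to\mathbb R$ be a uniformly strongly convex $\mathcal C^2$ function, i.e. there is $m>0$ such that $\lambda_{\min}(\nabla^2\psi(y))\ge m$ for all $y\in\mathbb R^d$. Let $y$ be an interior point of $\mathcal Y$ such that $\nabla\psi(y)$ is an interior point of $\mathcal X$, and assume that $g$ is continuous at $y$ and $f$ is continuous at $\nabla\psi(y)$. Then for every $\epsilon>0$ the integrals defining $\tilde\psi^\epsilon(y):=\mathcal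 V^\epsilon[\psi](y)$ (the inner one for every $x\in\mathbb R^d$) converge and are positive, so that $\tilde\psi^\epsilon(y)$ is a well-defined real number, and $$\lim_{\epsilon\downarrow 0}\frac{\tilde\psi^{\epsilon}(y)-\psi(y)}{\epsilon}=-f(\nabla\psi(y))+g(y)+\log\det\left(\nabla^2\psi(y)\right).$$ -/

import Mathlib

open MeasureTheory Filter Topology Real
open scoped RealInnerProductSpace

noncomputable section

/-- `exp (-f)` on `X`, extended by `0` outside `X`, is a probability density with respect to
Lebesgue measure on `ℝ^d`. -/
structure IsProbDensityOn {d : ℕ} (X : Set (EuclideanSpace ℝ (Fin d)))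
    (f : EuclideanSpace ℝ (Fin d) → ℝ) : Prop where
  measurableSet : MeasurableSet X
  integrableOn : IntegrableOn (fun x => exp (-f x)) X volume
  integral_eq_one : ∫ x in X, exp (-f x) = 1

/-- The Hessian of `ψ` at `y`, as the derivative of the gradient field. -/
def hessian {d : ℕ} (ψ : EuclideanSpace ℝ (Fin d) → ℝ) (y : EuclideanSpace ℝ (Fin d)) :
    EuclideanSpace ℝ (Fin d) →L[ℝ] EuclideanSpace ℝ (Fin d) :=
  fderiv ℝ (gradient ψ) y

/-- Every eigenvalue of every (symmetric) Hessian `∇²ψ(y)` is at least `m`,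
i.e. `m • Id ≤ ∇²ψ(y)` as quadratic forms, for all `y`. -/
def HessianBoundedBelow {d : ℕ} (m : ℝ) (ψ : EuclideanSpace ℝ (Fin d) → ℝ) : Prop :=
  ∀ y v : EuclideanSpace ℝ (Fin d), m * ‖v‖ ^ 2 ≤ ⟪v, hessian ψ y v⟫

/-- A uniformly strongly convex function of class `C²`. -/
structure IsUniformlyStronglyConvexC2 {d : ℕ} (ψ : EuclideanSpace ℝ (Fin d) → ℝ) : Prop where
  contDiff : ContDiff ℝ 2 ψ
  exists_pos : ∃ m : ℝ, 0 < m ∧ HessianBoundedBelow m ψ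

/-- The integrand in `y'` of the inner normalising integral of a Sinkhorn step. -/
def sinkhornInner {d : ℕ} (g : EuclideanSpace ℝ (Fin d) → ℝ) (ε : ℝ)
    (ψ : EuclideanSpace ℝ (Fin d) → ℝ) (x y' : EuclideanSpace ℝ (Fin d)) : ℝ :=
  exp (1 / ε * ⟪x, y'⟫ - 1 / ε * ψ y' - g y')

/-- The integrand in `x` of the outer integral of a Sinkhorn step, evaluated at `y`. -/
def sinkhornOuter {d : ℕ} (Y : Set (EuclideanSpace ℝ (Fin d)))
    (f g : EuclideanSpace ℝ (Fin d) → ℝ) (ε : ℝ) (ψ : EuclideanSpace ℝ (Fin d) → ℝ)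
    (y x : EuclideanSpace ℝ (Fin d)) : ℝ :=
  exp (1 / ε * ⟪x, y⟫) / (∫ y' in Y, sinkhornInner g ε ψ x y') * exp (-f x)

/-- The Sinkhorn operator at temperature `ε`, for the target density `exp (-f)` on `X` and the
reference density `exp (-g)` on `Y`. -/
def sinkhornStep {d : ℕ} (X Y : Set (EuclideanSpace ℝ (Fin d)))
    (f g : EuclideanSpace ℝ (Fin d) → ℝ) (ε : ℝ) (ψ : EuclideanSpace ℝ (Fin d) → ℝ)
    (y : EuclideanSpace ℝ (Fin d)) : ℝ :=
  ε * log (∫ x in X, sinkhornOuter Y f g ε ψ y x)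

end

/-! This is a Laplace expansion at scale `t = √ε`. With `x = ∇ψ(y) + t u` and `z = y + t v`, the
inner exponent is `(⟪x, y⟫ - ψ y) / ε + ⟪u, v⟫ - R / ε`, where `R` is the second-order Taylor
remainder of `ψ` at `y`. All large factors cancel in the outer integral except `exp (ψ y / ε)`, so
the quotient in the limit is exactly `log ∫ t⁻ᵈ N_t((x - ∇ψ(y)) / t)⁻¹ e^{-f(x)} dx` over `X`, with
`N_t` the rescaled inner integral.

As `t → 0`, `N_t(u)` tends to `e^{-g(y)}` times the Laplace transform of the Gaussian with precision
`∇²ψ(y)`. The integral over `u` of the reciprocal of that transform is `det ∇²ψ(y)`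
(`integral_inv_gaussian_laplace`), which gives the limit.

Both limits follow from `tendsto_integral_rescaled_kernel`, which needs exponential decay uniform in
`t`: strong convexity provides it for the inner kernel (`rescaledKernel_le`), and a lower bound on
`N_t` growing exponentially in `‖u‖` provides it for `N_t⁻¹` (`exists_le_rescaledNormalizer`). -/

/-! ### Concentration of rescaled kernels -/

theorem exists_exp_neg_half_le_inv_pow (n : ℕ) :
    ∃ K : ℝ, 0 < K ∧ ∀ r : ℝ, 0 ≤ r → exp (-(r / 2)) ≤ K * ((1 + r) ^ n)⁻¹ := by
  refine ⟨exp (1 / 2) * (n.factorial * 2 ^ n), by positivity, fun r hr => ?_⟩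
  have h := Real.pow_div_factorial_le_exp ((1 + r) / 2) (by positivity) n
  have hfac : (0 : ℝ) < n.factorial := by positivity
  rw [div_le_iff₀ hfac, div_pow, div_le_iff₀ (by positivity)] at h
  rw [← div_eq_mul_inv, le_div_iff₀ (by positivity)]
  calc exp (-(r / 2)) * (1 + r) ^ n
      ≤ exp (-(r / 2)) * (exp ((1 + r) / 2) * n.factorial * 2 ^ n) := by gcongr
    _ = exp (-(r / 2)) * exp ((1 + r) / 2) * (n.factorial * 2 ^ n) := by ring
    _ = exp (1 / 2) * (n.factorial * 2 ^ n) := by rw [← exp_add]; ring_nf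

theorem integrable_exp_neg_half_norm {d : ℕ} :
    Integrable (fun u : EuclideanSpace ℝ (Fin d) => exp (-(‖u‖ / 2))) := by
  obtain ⟨K, -, hK⟩ := exists_exp_neg_half_le_inv_pow (d + 1)
  have h := (integrable_one_add_norm (E := EuclideanSpace ℝ (Fin d)) (μ := volume)
    (r := (d + 1 : ℕ)) (by simp)).const_mul K
  refine h.mono' (by fun_prop) (ae_of_all _ fun u => ?_)
  rw [norm_of_nonneg (exp_pos _).le, rpow_neg (by positivity), rpow_natCast]
  exact hK _ (norm_nonneg _)

theorem integral_comp_inv_smul_sub {d : ℕ} (F : EuclideanSpace ℝ (Fin d) → ℝ)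
    (a : EuclideanSpace ℝ (Fin d)) {t : ℝ} (ht : 0 < t) :
    ∫ x, (t ^ d)⁻¹ * F (t⁻¹ • (x - a)) = ∫ u, F u := by
  rw [integral_const_mul, integral_sub_right_eq_self (fun x => F (t⁻¹ • x)) a,
    Measure.integral_comp_inv_smul_of_nonneg _ _ ht.le]
  simp [ht.ne']

/-- The exponentially decaying kernels `t⁻ᵈ h t ((x - a) / t)` concentrate at `a`. -/
theorem tendsto_integral_rescaled_kernel {d : ℕ} {w : EuclideanSpace ℝ (Fin d) → ℝ}
    {a : EuclideanSpace ℝ (Fin d)} (hw : Integrable w) (hwa : ContinuousAt w a)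
    {h : ℝ → EuclideanSpace ℝ (Fin d) → ℝ} {h₀ : EuclideanSpace ℝ (Fin d) → ℝ} {C t₀ : ℝ}
    (ht₀ : 0 < t₀) (hm : ∀ t, 0 < t → t ≤ t₀ → Measurable (h t))
    (hb : ∀ t, 0 < t → t ≤ t₀ → ∀ u, |h t u| ≤ C * exp (-(‖u‖ / 2)))
    (hlim : ∀ u, Tendsto (fun t => h t u) (𝓝[>] 0) (𝓝 (h₀ u))) :
    Tendsto (fun t : ℝ => ∫ x, (t ^ d)⁻¹ * h t (t⁻¹ • (x - a)) * w x) (𝓝[>] 0)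
      (𝓝 (w a * ∫ u, h₀ u)) := by
  have hC : 0 ≤ C := by
    have := (abs_nonneg _).trans (hb t₀ ht₀ le_rfl 0)
    simpa using this
  obtain ⟨δ, hδ, hwδ⟩ : ∃ δ > 0, ∀ x ∈ Metric.ball a δ, |w x| ≤ |w a| + 1 := by
    have : ∀ᶠ x in 𝓝 a, |w x| < |w a| + 1 :=
      hwa.abs.eventually_lt_const (by simp)
    obtain ⟨δ, hδ, hh⟩ := Metric.eventually_nhds_iff_ball.1 this
    exact ⟨δ, hδ, fun x hx => (hh x hx).le⟩
  -- Near `a` the density is bounded, so dominated convergence applies in the blown-up variable.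
  -- Away from `a` it is merely integrable, and the kernel itself must be uniformly small there.
  set w₁ := (Metric.ball a δ).indicator w with hw₁
  set w₂ := (Metric.ball a δ)ᶜ.indicator w with hw₂
  have hw₁i : Integrable w₁ := hw.indicator measurableSet_ball
  have hw₂i : Integrable w₂ := hw.indicator measurableSet_ball.compl
  have hsplit : ∀ x, w x = w₁ x + w₂ x := fun x =>
    (congrFun (Set.indicator_self_add_compl (Metric.ball a δ) w) x).symm
  have hev : ∀ᶠ t : ℝ in 𝓝[>] 0, 0 < t ∧ t ≤ t₀ := by
    filter_upwards [self_mem_nhdsWithin, nhdsWithin_le_nhds (Iic_mem_nhds ht₀)] with t h1 h2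
    exact ⟨h1, h2⟩
  have hint : ∀ t, 0 < t → t ≤ t₀ → ∀ v, Integrable v →
      Integrable (fun x => (t ^ d)⁻¹ * h t (t⁻¹ • (x - a)) * v x) := by
    intro t ht htt v hv
    refine hv.bdd_mul (c := (t ^ d)⁻¹ * C) ?_ (ae_of_all _ fun x => ?_)
    · exact (((hm t ht htt).comp (by fun_prop)).const_mul _).aestronglyMeasurable
    · rw [norm_mul, norm_of_nonneg (by positivity : 0 ≤ (t ^ d)⁻¹), norm_eq_abs]
      gcongr
      refine (hb t ht htt _).trans (mul_le_of_le_one_right hC ?_)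
      exact exp_le_one_iff.2 (by simp; positivity)
  have hlim₁ : Tendsto (fun t : ℝ => ∫ u, h t u * w₁ (a + t • u)) (𝓝[>] 0)
      (𝓝 (∫ u, h₀ u * w a)) := by
    refine tendsto_integral_filter_of_dominated_convergence
      (fun u => C * exp (-(‖u‖ / 2)) * (|w a| + 1)) ?_ ?_
      ((integrable_exp_neg_half_norm.const_mul C).mul_const _) ?_
    · filter_upwards [hev] with t ht
      refine (hm t ht.1 ht.2).aestronglyMeasurable.mul ?_
      exact ((hw₁i.comp_add_left a).comp_smul ht.1.ne').aestronglyMeasurable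
    · filter_upwards [hev] with t ht
      refine ae_of_all _ fun u => ?_
      rw [norm_mul, norm_eq_abs, norm_eq_abs]
      refine mul_le_mul (hb t ht.1 ht.2 u) ?_ (abs_nonneg _) (by positivity)
      by_cases hu : a + t • u ∈ Metric.ball a δ
      · rw [hw₁, Set.indicator_of_mem hu]; exact hwδ _ hu
      · rw [hw₁, Set.indicator_of_notMem hu]; simp; positivity
    · refine ae_of_all _ fun u => (hlim u).mul ?_
      have h1 : Tendsto (fun t : ℝ => a + t • u) (𝓝[>] 0) (𝓝 a) := by
        have : Continuous (fun t : ℝ => a + t • u) := by fun_prop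
        simpa using (this.tendsto 0).mono_left nhdsWithin_le_nhds
      have h2 : Tendsto w₁ (𝓝 a) (𝓝 (w a)) := by
        refine hwa.tendsto.congr' ?_
        filter_upwards [Metric.ball_mem_nhds a hδ] with x hx
        rw [hw₁, Set.indicator_of_mem hx]
      exact h2.comp h1
  have hlim₂ : Tendsto (fun t : ℝ => ∫ x, (t ^ d)⁻¹ * h t (t⁻¹ • (x - a)) * w₂ x) (𝓝[>] 0)
      (𝓝 0) := by
    -- The power `d + 1` beats the factor `t⁻ᵈ` and leaves one spare factor `t`.
    obtain ⟨K, hK0, hK⟩ := exists_exp_neg_half_le_inv_pow (d + 1)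
    refine squeeze_zero_norm' (a := fun t : ℝ => t * (C * K * (δ ^ (d + 1))⁻¹ * ∫ x, |w x|)) ?_ ?_
    · filter_upwards [hev] with t ⟨ht, htt⟩
      rw [← mul_assoc, ← integral_const_mul]
      refine norm_integral_le_of_norm_le (hw.abs.const_mul _) (ae_of_all _ fun x => ?_)
      by_cases hx : x ∈ Metric.ball a δ
      · rw [hw₂, Set.indicator_of_notMem (by simpa using hx)]
        simp; positivity
      rw [hw₂, Set.indicator_of_mem hx, norm_mul, norm_eq_abs (w x), norm_mul,
        norm_of_nonneg (by positivity : 0 ≤ (t ^ d)⁻¹), norm_eq_abs]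
      refine mul_le_mul_of_nonneg_right ?_ (abs_nonneg _)
      have hx' : δ / t ≤ ‖t⁻¹ • (x - a)‖ := by
        rw [norm_smul, norm_of_nonneg (by positivity), div_eq_inv_mul]
        gcongr
        simpa [dist_eq_norm] using hx
      have h1 := (hb t ht htt (t⁻¹ • (x - a))).trans
        (mul_le_mul_of_nonneg_left (hK _ (norm_nonneg _)) hC)
      have h2 : ((1 + ‖t⁻¹ • (x - a)‖) ^ (d + 1))⁻¹ ≤ ((δ / t) ^ (d + 1))⁻¹ := by
        gcongr
        linarith
      calc (t ^ d)⁻¹ * |h t (t⁻¹ • (x - a))|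
          ≤ (t ^ d)⁻¹ * (C * (K * ((δ / t) ^ (d + 1))⁻¹)) := by
            gcongr
            exact h1.trans (by gcongr)
        _ = t * (C * K * (δ ^ (d + 1))⁻¹) := by
            rw [div_pow]; field_simp; ring
    · have : Continuous (fun t : ℝ => t * (C * K * (δ ^ (d + 1))⁻¹ * ∫ x, |w x|)) := by fun_prop
      simpa using (this.tendsto 0).mono_left nhdsWithin_le_nhds
  have hfin := hlim₁.add hlim₂
  rw [integral_mul_const, add_zero, mul_comm] at hfin
  refine hfin.congr' ?_
  filter_upwards [hev] with t ⟨ht, htt⟩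
  rw [← integral_comp_inv_smul_sub _ a ht, ← integral_add]
  · refine integral_congr_ae (ae_of_all _ fun x => ?_)
    have : a + t • t⁻¹ • (x - a) = x := by rw [smul_smul, mul_inv_cancel₀ ht.ne']; simp
    simp only [this, hsplit x]
    ring
  · refine (hint t ht htt w₁ hw₁i).congr (ae_of_all _ fun x => ?_)
    have : a + t • t⁻¹ • (x - a) = x := by rw [smul_smul, mul_inv_cancel₀ ht.ne']; simp
    simp only [this]
    ring
  · exact hint t ht htt w₂ hw₂i

/-! ### Second-order Taylor estimates -/

section SecondOrderTaylor

variable {d : ℕ}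

theorem contDiff_gradient {ψ : EuclideanSpace ℝ (Fin d) → ℝ} (hψ : ContDiff ℝ 2 ψ) :
    ContDiff ℝ 1 (gradient ψ) :=
  (InnerProductSpace.toDual ℝ (EuclideanSpace ℝ (Fin d))).symm.contDiff.comp
    (hψ.fderiv_right (m := 1) (by norm_num))

theorem continuous_hessian {ψ : EuclideanSpace ℝ (Fin d) → ℝ} (hψ : ContDiff ℝ 2 ψ) :
    Continuous (hessian ψ) :=
  (contDiff_gradient hψ).continuous_fderiv (by norm_num)

theorem inner_hessian_eq {ψ : EuclideanSpace ℝ (Fin d) → ℝ} (hψ : ContDiff ℝ 2 ψ)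
    (y v w : EuclideanSpace ℝ (Fin d)) :
    ⟪hessian ψ y v, w⟫ = fderiv ℝ (fderiv ℝ ψ) y v w := by
  have h1 : HasFDerivAt (fderiv ℝ ψ) (fderiv ℝ (fderiv ℝ ψ) y) y :=
    ((hψ.fderiv_right (m := 1) (by norm_num)).differentiable (by norm_num) y).hasFDerivAt
  have h2 : HasFDerivAt (gradient ψ) _ y :=
    ((InnerProductSpace.toDual ℝ (EuclideanSpace ℝ
      (Fin d))).symm.toContinuousLinearEquiv.toContinuousLinearMap.hasFDerivAt).comp y h1
  rw [hessian, h2.fderiv]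
  simp

theorem hessian_isSymmetric {ψ : EuclideanSpace ℝ (Fin d) → ℝ} (hψ : ContDiff ℝ 2 ψ)
    (y : EuclideanSpace ℝ (Fin d)) : (hessian ψ y : EuclideanSpace ℝ (Fin d) →ₗ[ℝ]
      EuclideanSpace ℝ (Fin d)).IsSymmetric := by
  intro v w
  have h := (hψ.contDiffAt (x := y)).isSymmSndFDerivAt (by simp)
  change ⟪hessian ψ y v, w⟫ = ⟪v, hessian ψ y w⟫
  rw [real_inner_comm (hessian ψ y w) v, inner_hessian_eq hψ, inner_hessian_eq hψ]
  exact h.eq v w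

/-- Lagrange's remainder for `s ↦ ψ (y + s • w)` on `[0, 1]`. All later bounds on the remainder come
from this identity. -/
theorem exists_taylor_hessian {ψ : EuclideanSpace ℝ (Fin d) → ℝ} (hψ : ContDiff ℝ 2 ψ)
    (y w : EuclideanSpace ℝ (Fin d)) :
    ∃ s ∈ Set.Ioo (0 : ℝ) 1,
      ψ (y + w) - ψ y - ⟪gradient ψ y, w⟫ = ⟪w, hessian ψ (y + s • w) w⟫ / 2 := by
  have hl : ∀ s : ℝ, HasDerivAt (fun s : ℝ => y + s • w) w s := fun s => by
    simpa using ((hasDerivAt_id s).smul_const w).const_add y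
  have hd1 : ∀ s : ℝ, HasDerivAt (fun s : ℝ => ψ (y + s • w)) ⟪gradient ψ (y + s • w), w⟫ s := by
    intro s
    have h := (hψ.differentiable (by norm_num) (y + s • w)).hasGradientAt.hasFDerivAt
    have h' := h.comp_hasDerivAt s (hl s)
    rw [InnerProductSpace.toDual_apply_apply] at h'
    exact h'
  have hd2 : ∀ s : ℝ, HasDerivAt (fun s : ℝ => ⟪gradient ψ (y + s • w), w⟫)
      ⟪w, hessian ψ (y + s • w) w⟫ s := by
    intro s
    have h := ((contDiff_gradient hψ).differentiable (by norm_num) (y + s • w)).hasFDerivAt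
    have h' := (h.comp_hasDerivAt s (hl s)).inner ℝ (hasDerivAt_const s w)
    simpa [hessian, real_inner_comm] using h'
  have hc : ContDiffOn ℝ ((1 : ℕ) + 1) (fun s : ℝ => ψ (y + s • w)) (Set.uIcc 0 1) := by
    have : ContDiff ℝ 2 (fun s : ℝ => ψ (y + s • w)) := hψ.comp (by fun_prop)
    exact (this.of_le (by norm_num)).contDiffOn
  obtain ⟨s, hs, h⟩ := taylor_mean_remainder_lagrange_iteratedDeriv
    (zero_ne_one) hc
  rw [Set.uIoo_of_le zero_le_one] at hs
  refine ⟨s, hs, ?_⟩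
  have e1 : deriv (fun s : ℝ => ψ (y + s • w)) = fun s => ⟪gradient ψ (y + s • w), w⟫ :=
    funext fun s => (hd1 s).deriv
  have hu : UniqueDiffWithinAt ℝ (Set.uIcc (0 : ℝ) 1) 0 :=
    uniqueDiffOn_uIcc zero_ne_one 0 (by simp)
  rw [taylorWithinEval_succ, taylor_within_zero_eval, iteratedDerivWithin_one,
    (hd1 0).hasDerivWithinAt.derivWithin hu] at h
  simp only [iteratedDeriv_succ, iteratedDeriv_zero, e1, (hd2 s).deriv] at h
  norm_num [-inner_gradient_left] at h
  linarith

theorem taylor_lower_bound {ψ : EuclideanSpace ℝ (Fin d) → ℝ} (hψ : ContDiff ℝ 2 ψ)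
    {m : ℝ} (hm : HessianBoundedBelow m ψ) (y w : EuclideanSpace ℝ (Fin d)) :
    m / 2 * ‖w‖ ^ 2 ≤ ψ (y + w) - ψ y - ⟪gradient ψ y, w⟫ := by
  obtain ⟨s, -, h⟩ := exists_taylor_hessian hψ y w
  rw [h]
  linarith [hm (y + s • w) w]

theorem exists_taylor_upper_bound {ψ : EuclideanSpace ℝ (Fin d) → ℝ} (hψ : ContDiff ℝ 2 ψ)
    (y : EuclideanSpace ℝ (Fin d)) : ∃ M > 0, ∃ δ > 0, ∀ w, ‖w‖ < δ →
      ψ (y + w) - ψ y - ⟪gradient ψ y, w⟫ ≤ M * ‖w‖ ^ 2 := by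
  have h1 : ∀ᶠ z in 𝓝 y, ‖hessian ψ z‖ < ‖hessian ψ y‖ + 1 :=
    (continuous_hessian hψ).norm.continuousAt.eventually_lt_const (by simp)
  obtain ⟨δ, hδ, h⟩ := Metric.eventually_nhds_iff_ball.1 h1
  refine ⟨‖hessian ψ y‖ + 1, by positivity, δ, hδ, fun w hw => ?_⟩
  obtain ⟨s, hs, hT⟩ := exists_taylor_hessian hψ y w
  have hs' : y + s • w ∈ Metric.ball y δ := by
    simp only [mem_ball_iff_norm, add_sub_cancel_left, norm_smul, norm_of_nonneg hs.1.le]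
    exact lt_of_le_of_lt (mul_le_of_le_one_left (norm_nonneg _) hs.2.le) hw
  have h2 : ⟪w, hessian ψ (y + s • w) w⟫ ≤ (‖hessian ψ y‖ + 1) * ‖w‖ ^ 2 := by
    calc ⟪w, hessian ψ (y + s • w) w⟫ ≤ ‖w‖ * ‖hessian ψ (y + s • w) w‖ := real_inner_le_norm _ _
      _ ≤ ‖w‖ * (‖hessian ψ (y + s • w)‖ * ‖w‖) := by gcongr; exact ContinuousLinearMap.le_opNorm _ _
      _ ≤ ‖w‖ * ((‖hessian ψ y‖ + 1) * ‖w‖) := by gcongr; exact (h _ hs').le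
      _ = _ := by ring
  have : 0 ≤ (‖hessian ψ y‖ + 1) * ‖w‖ ^ 2 := by positivity
  linarith

theorem tendsto_taylor_remainder_div_sq {ψ : EuclideanSpace ℝ (Fin d) → ℝ}
    (hψ : ContDiff ℝ 2 ψ) (y v : EuclideanSpace ℝ (Fin d)) :
    Tendsto (fun t : ℝ => (ψ (y + t • v) - ψ y - ⟪gradient ψ y, t • v⟫) / t ^ 2) (𝓝[>] 0)
      (𝓝 (⟪v, hessian ψ y v⟫ / 2)) := by
  -- The intermediate point is uncontrolled, but it lies between `y` and `y + t • v`, so continuity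
  -- of the Hessian suffices.
  choose s hs h using fun w => exists_taylor_hessian hψ y w
  have h1 : Tendsto (fun t : ℝ => y + s (t • v) • t • v) (𝓝[>] 0) (𝓝 y) := by
    have h2 : Tendsto (fun t : ℝ => s (t • v) • t • v) (𝓝[>] 0) (𝓝 0) := by
      refine squeeze_zero_norm (a := fun t : ℝ => ‖t • v‖) (fun t => ?_) ?_
      · rw [norm_smul, norm_of_nonneg (hs _).1.le]
        exact mul_le_of_le_one_left (norm_nonneg _) (hs _).2.le
      · have : Continuous (fun t : ℝ => ‖t • v‖) := by fun_prop
        simpa using (this.tendsto 0).mono_left nhdsWithin_le_nhds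
    simpa using h2.const_add y
  have hc : Continuous (fun z => ⟪v, hessian ψ z v⟫ / 2) :=
    (continuous_const.inner ((continuous_hessian hψ).clm_apply continuous_const)).div_const _
  refine ((hc.tendsto y).comp h1).congr' ?_
  filter_upwards [self_mem_nhdsWithin] with t (ht : 0 < t)
  rw [h]
  simp only [Function.comp, map_smul, inner_smul_left, inner_smul_right]
  simp
  field_simp

end SecondOrderTaylor

/-! ### Gaussian integrals and the determinant -/

theorem integral_comp_linearMap {d : ℕ} (B : EuclideanSpace ℝ (Fin d) →ₗ[ℝ] EuclideanSpace ℝ (Fin d))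
    (hB : LinearMap.det B ≠ 0) (F : EuclideanSpace ℝ (Fin d) → ℝ) :
    ∫ v, F (B v) = |LinearMap.det B|⁻¹ * ∫ z, F z := by
  have h := Measure.map_linearMap_addHaar_eq_smul_addHaar volume hB
  let e : EuclideanSpace ℝ (Fin d) ≃L[ℝ] EuclideanSpace ℝ (Fin d) :=
    (LinearMap.equivOfDetNeZero B hB).toContinuousLinearEquiv
  have he : ∫ z, F z ∂(Measure.map B volume) = ∫ v, F (B v) :=
    e.toHomeomorph.measurableEmbedding.integral_map F
  rw [← he, h, integral_smul_measure, ENNReal.toReal_ofReal (abs_nonneg _), abs_inv, smul_eq_mul]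

theorem exists_adjoint_comp_self_of_isPositive {d : ℕ}
    {A : EuclideanSpace ℝ (Fin d) →ₗ[ℝ] EuclideanSpace ℝ (Fin d)} (hA : A.IsPositive) :
    ∃ B : EuclideanSpace ℝ (Fin d) →ₗ[ℝ] EuclideanSpace ℝ (Fin d), A = LinearMap.adjoint B * B := by
  classical
  let b := EuclideanSpace.basisFun (Fin d) ℝ
  have h : (LinearMap.toMatrixOrthonormal b A).PosSemidef :=
    (LinearMap.posSemidef_toMatrix_iff b).2 hA
  open scoped MatrixOrder in
  obtain ⟨X, hX⟩ := CStarAlgebra.nonneg_iff_eq_star_mul_self.1 h.nonneg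
  refine ⟨(LinearMap.toMatrixOrthonormal b).symm X, ?_⟩
  apply (LinearMap.toMatrixOrthonormal b).injective
  change LinearMap.toMatrixOrthonormal b A = LinearMap.toMatrixOrthonormal b _
  rw [hX, ← LinearMap.star_eq_adjoint, map_mul, map_star, StarAlgEquiv.apply_symm_apply]

theorem integral_exp_inner_sub_sq {d : ℕ} (p : EuclideanSpace ℝ (Fin d)) :
    ∫ z, exp (⟪p, z⟫ - ‖z‖ ^ 2 / 2) = exp (‖p‖ ^ 2 / 2) * (2 * π) ^ (d / 2 : ℝ) := by
  have h : ∀ z : EuclideanSpace ℝ (Fin d), exp (⟪p, z⟫ - ‖z‖ ^ 2 / 2)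
      = exp (‖p‖ ^ 2 / 2) * exp (-(1 / 2) * ‖z - p‖ ^ 2) := fun z => by
    rw [← exp_add, norm_sub_sq_real, real_inner_comm]
    ring_nf
  simp_rw [h]
  rw [integral_const_mul,
    integral_sub_right_eq_self (fun z : EuclideanSpace ℝ (Fin d) => exp (-(1 / 2) * ‖z‖ ^ 2)) p,
    GaussianFourier.integral_rexp_neg_mul_sq_norm (by norm_num)]
  simp [mul_comm]

/-- The Laplace transform of the Gaussian kernel of a positive definite operator `A` is positive,
and the integral of its reciprocal is `det A`. -/
theorem integral_inv_gaussian_laplace {d : ℕ}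
    {A : EuclideanSpace ℝ (Fin d) →L[ℝ] EuclideanSpace ℝ (Fin d)}
    (hA : (A : EuclideanSpace ℝ (Fin d) →ₗ[ℝ] EuclideanSpace ℝ (Fin d)).IsSymmetric)
    {m : ℝ} (hm : 0 < m) (hmA : ∀ v, m * ‖v‖ ^ 2 ≤ ⟪v, A v⟫) :
    0 < A.det ∧ (∀ u, 0 < ∫ v, exp (⟪u, v⟫ - ⟪v, A v⟫ / 2)) ∧
      ∫ u, (∫ v, exp (⟪u, v⟫ - ⟪v, A v⟫ / 2))⁻¹ = A.det := by
  have hA0 : ∀ v, 0 ≤ ⟪A v, v⟫ := fun v => by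
    rw [real_inner_comm]
    exact le_trans (by positivity) (hmA v)
  obtain ⟨B, hB⟩ := exists_adjoint_comp_self_of_isPositive
    (A := (A : EuclideanSpace ℝ (Fin d) →ₗ[ℝ] EuclideanSpace ℝ (Fin d))) ⟨hA, hA0⟩
  have hAB : ∀ v, ⟪v, A v⟫ = ‖B v‖ ^ 2 := fun v => by
    have : A v = (LinearMap.adjoint B) (B v) := congrArg (fun L => L v) hB
    rw [this, LinearMap.adjoint_inner_right, real_inner_self_eq_norm_sq]
  have hBinj : LinearMap.ker B = ⊥ := by
    rw [LinearMap.ker_eq_bot']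
    intro v hv
    have h := hmA v
    rw [hAB, hv, norm_zero] at h
    have h2 : ‖v‖ ^ 2 ≤ 0 := by nlinarith
    simpa using le_antisymm h2 (sq_nonneg _)
  have hdet : LinearMap.det B ≠ 0 := by
    rwa [ne_eq, LinearMap.det_eq_zero_iff_ker_ne_bot, not_not]
  have hdetadj : LinearMap.det (LinearMap.adjoint B) = LinearMap.det B := by
    let b := EuclideanSpace.basisFun (Fin d) ℝ
    rw [← LinearMap.det_toMatrix b.toBasis, LinearMap.toMatrix_adjoint b b, Matrix.det_conjTranspose,
      LinearMap.det_toMatrix b.toBasis]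
    simp
  have hdetA : A.det = |LinearMap.det B| ^ 2 := by
    rw [ContinuousLinearMap.det, hB, map_mul, hdetadj, sq_abs, sq]
  -- `L` is the inverse adjoint of `B`: under `z = B v`, `⟪u, v⟫` becomes `⟪L u, z⟫` and `⟪v, A v⟫`
  -- becomes `‖z‖ ^ 2`.
  let e := LinearMap.equivOfDetNeZero B hdet
  set L := LinearMap.adjoint (e.symm : EuclideanSpace ℝ (Fin d) →ₗ[ℝ] EuclideanSpace ℝ (Fin d))
    with hL
  have hLB : LinearMap.adjoint B * L = 1 := by
    have h1 : (e.symm : EuclideanSpace ℝ (Fin d) →ₗ[ℝ] EuclideanSpace ℝ (Fin d)) * B = 1 := by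
      ext1 v
      exact e.symm_apply_apply v
    have h2 := congrArg LinearMap.adjoint h1
    rw [← LinearMap.star_eq_adjoint, ← LinearMap.star_eq_adjoint, star_mul, star_one] at h2
    exact h2
  have hdetL : LinearMap.det B * LinearMap.det L = 1 := by
    rw [← hdetadj, ← map_mul, hLB, map_one]
  have hK : ∀ u, ∫ v, exp (⟪u, v⟫ - ⟪v, A v⟫ / 2)
      = |LinearMap.det B|⁻¹ * (exp (‖L u‖ ^ 2 / 2) * (2 * π) ^ (d / 2 : ℝ)) := fun u => by
    rw [← integral_exp_inner_sub_sq, ← integral_comp_linearMap B hdet]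
    congr 1
    ext v
    have h1 : ⟪L u, B v⟫ = ⟪u, v⟫ := by
      rw [hL, LinearMap.adjoint_inner_left]
      congr 1
      exact e.symm_apply_apply v
    rw [h1, hAB]
  have hpos : 0 < |LinearMap.det B| := abs_pos.2 hdet
  refine ⟨hdetA ▸ by positivity, fun u => hK u ▸ by positivity, ?_⟩
  -- The reciprocal is again Gaussian in `L u`; the null term `⟪0, L u⟫` lets
  -- `integral_exp_inner_sub_sq` apply a second time, with `p = 0`. The powers of `2π` cancel and
  -- two factors `|det B|` remain.
  have h1 : ∀ u, (∫ v, exp (⟪u, v⟫ - ⟪v, A v⟫ / 2))⁻¹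
      = |LinearMap.det B| * ((2 * π) ^ (d / 2 : ℝ))⁻¹ * exp (⟪0, L u⟫ - ‖L u‖ ^ 2 / 2) := fun u => by
    rw [hK, mul_inv, mul_inv, inv_inv, inner_zero_left, zero_sub, exp_neg]
    ring
  have hLne : LinearMap.det L ≠ 0 := right_ne_zero_of_mul_eq_one hdetL
  have hLabs : |LinearMap.det L|⁻¹ = |LinearMap.det B| := by
    exact inv_eq_of_mul_eq_one_left (by rw [← abs_mul, hdetL, abs_one])
  simp_rw [h1]
  rw [integral_const_mul, integral_comp_linearMap L hLne (fun z => exp (⟪0, z⟫ - ‖z‖ ^ 2 / 2)),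
    integral_exp_inner_sub_sq, hLabs, hdetA]
  simp only [norm_zero]
  field_simp
  simp

/-! ### Bounds and limit of the rescaled inner integral -/

section RescaledNormalizer

/-- The inner integrand of a Sinkhorn step at scale `t = √ε` around `y`, without the density. -/
noncomputable def rescaledKernel {d : ℕ} (ψ : EuclideanSpace ℝ (Fin d) → ℝ)
    (y : EuclideanSpace ℝ (Fin d)) (t : ℝ) (u v : EuclideanSpace ℝ (Fin d)) : ℝ :=
  exp (⟪u, v⟫ - (ψ (y + t • v) - ψ y - ⟪gradient ψ y, t • v⟫) / t ^ 2)

/-- The inner integral of a Sinkhorn step at scale `t = √ε` around `y`, with density `w`. -/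
noncomputable def rescaledNormalizer {d : ℕ} (ψ w : EuclideanSpace ℝ (Fin d) → ℝ)
    (y : EuclideanSpace ℝ (Fin d)) (t : ℝ) (u : EuclideanSpace ℝ (Fin d)) : ℝ :=
  ∫ z, (t ^ d)⁻¹ * rescaledKernel ψ y t u (t⁻¹ • (z - y)) * w z

variable {d : ℕ} {ψ w : EuclideanSpace ℝ (Fin d) → ℝ} {y : EuclideanSpace ℝ (Fin d)} {m : ℝ}

theorem continuous_rescaledKernel (hψ : Continuous ψ) (t : ℝ) :
    Continuous fun p : EuclideanSpace ℝ (Fin d) × EuclideanSpace ℝ (Fin d) =>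
      rescaledKernel ψ y t p.1 p.2 := by
  unfold rescaledKernel
  fun_prop

/-- The exponent is at most `‖u‖ ‖v‖ - m ‖v‖² / 2`; setting aside `-‖v‖ / 2` and completing the
square in `‖v‖` leaves a constant that depends on `u` but not on `t`. -/
theorem rescaledKernel_le (hψ : ContDiff ℝ 2 ψ) (hm : 0 < m) (hH : HessianBoundedBelow m ψ)
    {t : ℝ} (ht : 0 < t) (u v : EuclideanSpace ℝ (Fin d)) :
    rescaledKernel ψ y t u v ≤ exp ((‖u‖ + 1 / 2) ^ 2 / (2 * m)) * exp (-(‖v‖ / 2)) := by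
  have h1 := taylor_lower_bound hψ hH y (t • v)
  have h2 : m / 2 * ‖v‖ ^ 2 ≤ (ψ (y + t • v) - ψ y - ⟪gradient ψ y, t • v⟫) / t ^ 2 := by
    rw [le_div_iff₀ (by positivity)]
    rw [norm_smul, norm_of_nonneg ht.le] at h1
    linarith
  have h3 : ⟪u, v⟫ ≤ ‖u‖ * ‖v‖ := real_inner_le_norm _ _
  have h4 : (‖u‖ + 1 / 2) * ‖v‖ - m / 2 * ‖v‖ ^ 2 ≤ (‖u‖ + 1 / 2) ^ 2 / (2 * m) := by
    rw [le_div_iff₀ (by positivity)]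
    nlinarith [sq_nonneg (‖u‖ + 1 / 2 - m * ‖v‖)]
  rw [rescaledKernel, ← exp_add, exp_le_exp]
  linarith

theorem tendsto_rescaledKernel (hψ : ContDiff ℝ 2 ψ) (u v : EuclideanSpace ℝ (Fin d)) :
    Tendsto (fun t => rescaledKernel ψ y t u v) (𝓝[>] 0)
      (𝓝 (exp (⟪u, v⟫ - ⟪v, hessian ψ y v⟫ / 2))) :=
  (continuous_exp.tendsto _).comp ((tendsto_taylor_remainder_div_sq hψ y v).const_sub _)

theorem integrable_rescaledKernel_mul (hψ : ContDiff ℝ 2 ψ) (hm : 0 < m)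
    (hH : HessianBoundedBelow m ψ) (hw : Integrable w) {t : ℝ} (ht : 0 < t)
    (u : EuclideanSpace ℝ (Fin d)) :
    Integrable fun z => (t ^ d)⁻¹ * rescaledKernel ψ y t u (t⁻¹ • (z - y)) * w z := by
  refine hw.bdd_mul (c := (t ^ d)⁻¹ * exp ((‖u‖ + 1 / 2) ^ 2 / (2 * m))) ?_
    (ae_of_all _ fun z => ?_)
  · have : Continuous fun z => rescaledKernel ψ y t u (t⁻¹ • (z - y)) :=
      (continuous_rescaledKernel hψ.continuous t).comp (by fun_prop :
        Continuous fun z : EuclideanSpace ℝ (Fin d) => (u, t⁻¹ • (z - y)))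
    exact (this.const_mul _).aestronglyMeasurable
  · rw [norm_mul, norm_of_nonneg (by positivity : 0 ≤ (t ^ d)⁻¹),
      norm_of_nonneg (by unfold rescaledKernel; positivity)]
    gcongr
    refine (rescaledKernel_le hψ hm hH ht _ _).trans (mul_le_of_le_one_right (exp_pos _).le ?_)
    exact exp_le_one_iff.2 (neg_nonpos.2 (by positivity))

theorem measurable_rescaledNormalizer (hψ : Continuous ψ) (hw : Integrable w) (t : ℝ) :
    Measurable (rescaledNormalizer ψ w y t) := by
  -- `w` is only a.e. strongly measurable, so a strongly measurable representative is needed for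
  -- joint measurability.
  have h1 : rescaledNormalizer ψ w y t = fun u => ∫ z,
      (t ^ d)⁻¹ * rescaledKernel ψ y t u (t⁻¹ • (z - y)) * hw.aestronglyMeasurable.mk w z := by
    ext u
    refine integral_congr_ae ?_
    filter_upwards [hw.aestronglyMeasurable.ae_eq_mk] with z hz
    rw [← hz]
  rw [h1]
  have h2 : Continuous fun p : EuclideanSpace ℝ (Fin d) × EuclideanSpace ℝ (Fin d) =>
      (t ^ d)⁻¹ * rescaledKernel ψ y t p.1 (t⁻¹ • (p.2 - y)) :=
    continuous_const.mul ((continuous_rescaledKernel hψ t).comp (by fun_prop :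
      Continuous fun p : EuclideanSpace ℝ (Fin d) × EuclideanSpace ℝ (Fin d) =>
        (p.1, t⁻¹ • (p.2 - y))))
  have h3 : StronglyMeasurable fun p : EuclideanSpace ℝ (Fin d) × EuclideanSpace ℝ (Fin d) =>
      (t ^ d)⁻¹ * rescaledKernel ψ y t p.1 (t⁻¹ • (p.2 - y)) *
        hw.aestronglyMeasurable.mk w p.2 :=
    h2.stronglyMeasurable.mul
      (hw.aestronglyMeasurable.stronglyMeasurable_mk.comp_measurable measurable_snd)
  exact h3.integral_prod_right'.measurable

theorem tendsto_rescaledNormalizer (hψ : ContDiff ℝ 2 ψ) (hm : 0 < m)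
    (hH : HessianBoundedBelow m ψ) (hw : Integrable w) (hwy : ContinuousAt w y)
    (u : EuclideanSpace ℝ (Fin d)) :
    Tendsto (fun t => rescaledNormalizer ψ w y t u) (𝓝[>] 0)
      (𝓝 (w y * ∫ v, exp (⟪u, v⟫ - ⟪v, hessian ψ y v⟫ / 2))) := by
  refine tendsto_integral_rescaled_kernel hw hwy (h := fun t => rescaledKernel ψ y t u) one_pos
    (C := exp ((‖u‖ + 1 / 2) ^ 2 / (2 * m))) (fun t _ _ => ?_) (fun t ht _ v => ?_)
    (tendsto_rescaledKernel hψ u)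
  · exact ((continuous_rescaledKernel hψ.continuous t).comp (by fun_prop :
      Continuous fun v : EuclideanSpace ℝ (Fin d) => (u, v))).measurable
  · rw [abs_of_nonneg (by unfold rescaledKernel; positivity)]
    exact rescaledKernel_le hψ hm hH ht u v

/-- Integrating over a ball of radius `s / 2` centred at distance `s` from `y` in the direction
`u` bounds the normalizer from below. -/
theorem exists_le_rescaledNormalizer (hψ : ContDiff ℝ 2 ψ) (hm : 0 < m)
    (hH : HessianBoundedBelow m ψ) (hw : Integrable w) (hwy : ContinuousAt w y)
    (hw0 : ∀ z, 0 ≤ w z) (hwpos : 0 < w y) :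
    ∃ c > 0, ∃ M > 0, ∃ s₀ > 0, ∀ s, 0 < s → s ≤ s₀ → ∀ t, 0 < t → ∀ u,
      c * (s / t) ^ d * exp (s / t * (‖u‖ / 2) - M * (s / t) ^ 2) ≤
        rescaledNormalizer ψ w y t u := by
  obtain ⟨M, hM, δ, hδ, hT⟩ := exists_taylor_upper_bound hψ y
  obtain ⟨δ', hδ', hwδ⟩ := Metric.eventually_nhds_iff_ball.1
    (hwy.eventually_const_lt (half_lt_self hwpos))
  set V := volume.real (Metric.ball (0 : EuclideanSpace ℝ (Fin d)) (1 / 2))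
  have hV : 0 < V := ENNReal.toReal_pos
    (Metric.measure_ball_pos _ _ (by norm_num)).ne' measure_ball_lt_top.ne
  -- Points of the ball satisfy `‖z - y‖ < 2 * s`; hence the factor `4` on `M` and the halved
  -- radius.
  refine ⟨w y / 2 * V, by positivity, 4 * M, by positivity, min δ δ' / 2, by positivity,
    fun s hs hss t ht u => ?_⟩
  have hsδ : 2 * s ≤ δ := by linarith [min_le_left δ δ']
  have hsδ' : 2 * s ≤ δ' := by linarith [min_le_right δ δ']
  -- For `u = 0` this is `e = 0`, so only `‖e‖ ≤ 1` is claimed.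
  set e : EuclideanSpace ℝ (Fin d) := ‖u‖⁻¹ • u with he
  have hue : ⟪u, e⟫ = ‖u‖ := by
    rw [he, inner_smul_right, real_inner_self_eq_norm_sq]
    rcases eq_or_ne ‖u‖ 0 with h | h
    · simp [h]
    · field_simp
  have hene : ‖e‖ ≤ 1 := by
    rw [he, norm_smul, norm_inv, norm_norm]
    exact inv_mul_le_one
  set S := Metric.ball (y + s • e) (s / 2) with hS
  have hvol : volume.real S = s ^ d * V := by
    rw [hS, div_eq_mul_one_div, measureReal_def,
      Measure.addHaar_ball_mul_of_pos volume _ hs (1 / 2), ENNReal.toReal_mul,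
      ENNReal.toReal_ofReal (by positivity), finrank_euclideanSpace_fin, ← measureReal_def]
  have hpt : ∀ z ∈ S, (t ^ d)⁻¹ * exp (s / t * (‖u‖ / 2) - 4 * M * (s / t) ^ 2) * (w y / 2) ≤
      (t ^ d)⁻¹ * rescaledKernel ψ y t u (t⁻¹ • (z - y)) * w z := by
    intro z hz
    have hz' : ‖(z - y) - s • e‖ < s / 2 := by
      rw [hS, mem_ball_iff_norm] at hz
      rwa [sub_sub]
    have hzn : ‖z - y‖ < 2 * s := by
      have h1 : ‖s • e‖ ≤ s := by
        rw [norm_smul, norm_of_nonneg hs.le]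
        exact mul_le_of_le_one_right hs.le hene
      have h2 := norm_add_le ((z - y) - s • e) (s • e)
      rw [sub_add_cancel] at h2
      linarith
    have hin : s * (‖u‖ / 2) ≤ ⟪u, z - y⟫ := by
      have h1 : ⟪u, z - y⟫ = s * ‖u‖ + ⟪u, (z - y) - s • e⟫ := by
        rw [inner_sub_right u (z - y), inner_smul_right, hue]
        ring
      have h2 := (abs_le.1 (abs_real_inner_le_norm u ((z - y) - s • e))).1
      have h3 : ‖u‖ * ‖(z - y) - s • e‖ ≤ ‖u‖ * (s / 2) := by gcongr
      rw [h1]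
      linarith
    have hTz := hT (z - y) (hzn.trans_le hsδ)
    have hTz' : ψ (y + (z - y)) - ψ y - ⟪gradient ψ y, z - y⟫ ≤ 4 * M * s ^ 2 := by
      refine hTz.trans ?_
      have : ‖z - y‖ ^ 2 ≤ (2 * s) ^ 2 := by gcongr
      nlinarith
    have hwz : w y / 2 ≤ w z := (hwδ z (by
      rw [mem_ball_iff_norm]; exact hzn.trans_le hsδ')).le
    have hk : exp (s / t * (‖u‖ / 2) - 4 * M * (s / t) ^ 2) ≤
        rescaledKernel ψ y t u (t⁻¹ • (z - y)) := by
      rw [rescaledKernel, exp_le_exp, smul_smul, mul_inv_cancel₀ ht.ne', one_smul,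
        inner_smul_right]
      have h1 : s / t * (‖u‖ / 2) ≤ t⁻¹ * ⟪u, z - y⟫ := by
        rw [div_mul_eq_mul_div, div_eq_inv_mul]
        gcongr
      have h2 : (ψ (y + (z - y)) - ψ y - ⟪gradient ψ y, z - y⟫) / t ^ 2 ≤
          4 * M * (s / t) ^ 2 := by
        rw [div_pow, ← mul_div_assoc]
        gcongr
      linarith
    have hk0 : 0 ≤ rescaledKernel ψ y t u (t⁻¹ • (z - y)) := (exp_pos _).le
    gcongr
  have hi := integrable_rescaledKernel_mul (y := y) hψ hm hH hw ht u
  calc w y / 2 * V * (s / t) ^ d * exp (s / t * (‖u‖ / 2) - 4 * M * (s / t) ^ 2)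
      = ∫ _ in S, (t ^ d)⁻¹ * exp (s / t * (‖u‖ / 2) - 4 * M * (s / t) ^ 2) * (w y / 2) := by
        rw [setIntegral_const, hvol, smul_eq_mul, div_pow]
        field_simp
    _ ≤ ∫ z in S, (t ^ d)⁻¹ * rescaledKernel ψ y t u (t⁻¹ • (z - y)) * w z :=
        setIntegral_mono_on (integrableOn_const measure_ball_lt_top.ne) hi.integrableOn
          measurableSet_ball hpt
    _ ≤ rescaledNormalizer ψ w y t u :=
        setIntegral_le_integral hi (ae_of_all _ fun z => by
          have := hw0 z
          unfold rescaledKernel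
          simp only [Pi.zero_apply]
          positivity)

end RescaledNormalizer

/-! ### From the rescaled integrals to the Sinkhorn step -/

section SinkhornStep

variable {d : ℕ} {ψ f g : EuclideanSpace ℝ (Fin d) → ℝ} {X Y : Set (EuclideanSpace ℝ (Fin d))}
  {x₀ y : EuclideanSpace ℝ (Fin d)} {m : ℝ}

theorem IsProbDensityOn.integrable_indicator (hg : IsProbDensityOn Y g) :
    Integrable (Y.indicator fun z => exp (-g z)) :=
  hg.integrableOn.integrable_indicator hg.measurableSet

theorem continuousAt_indicator_exp_neg (hy : y ∈ interior Y) (hgc : ContinuousAt g y) :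
    ContinuousAt (Y.indicator fun z => exp (-g z)) y := by
  have h : ContinuousAt (fun z => exp (-g z)) y := hgc.neg.rexp
  refine h.congr ?_
  filter_upwards [mem_interior_iff_mem_nhds.1 hy] with z hz
  rw [Set.indicator_of_mem hz]

/-- Expanding at `y`, `⟪x, z⟫ - ψ z` equals `⟪x, y⟫ - ψ y + ⟪x - ∇ψ(y), z - y⟫` minus the Taylor
remainder; the first two terms leave the integral. -/
theorem sinkhornInner_eq_rescaledKernel {t : ℝ} (ht : 0 < t)
    (x y z : EuclideanSpace ℝ (Fin d)) :
    sinkhornInner g (t ^ 2) ψ x z = exp ((⟪x, y⟫ - ψ y) / t ^ 2) * t ^ d * ((t ^ d)⁻¹ *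
      rescaledKernel ψ y t (t⁻¹ • (x - gradient ψ y)) (t⁻¹ • (z - y)) * exp (-g z)) := by
  have h : exp ((⟪x, y⟫ - ψ y) / t ^ 2) * t ^ d * ((t ^ d)⁻¹ *
      rescaledKernel ψ y t (t⁻¹ • (x - gradient ψ y)) (t⁻¹ • (z - y)) * exp (-g z)) =
      exp ((⟪x, y⟫ - ψ y) / t ^ 2) *
        rescaledKernel ψ y t (t⁻¹ • (x - gradient ψ y)) (t⁻¹ • (z - y)) * exp (-g z) := by
    field_simp
  rw [h, sinkhornInner, rescaledKernel, ← exp_add, ← exp_add, smul_smul, mul_inv_cancel₀ ht.ne',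
    one_smul, real_inner_smul_left, real_inner_smul_right, add_sub_cancel, inner_sub_left,
    inner_sub_right x, inner_sub_right (gradient ψ y)]
  congr 1
  field_simp
  ring

theorem integrableOn_sinkhornInner (hψ : ContDiff ℝ 2 ψ) (hm : 0 < m)
    (hH : HessianBoundedBelow m ψ) (hg : IsProbDensityOn Y g) {t : ℝ} (ht : 0 < t)
    (x : EuclideanSpace ℝ (Fin d)) : IntegrableOn (sinkhornInner g (t ^ 2) ψ x) Y := by
  rw [← integrable_indicator_iff hg.measurableSet]
  -- Integrability does not depend on the expansion point, so `0` serves.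
  refine ((integrable_rescaledKernel_mul (y := 0) hψ hm hH hg.integrable_indicator ht
    (t⁻¹ • (x - gradient ψ 0))).const_mul (exp ((⟪x, 0⟫ - ψ 0) / t ^ 2) * t ^ d)).congr
    (ae_of_all _ fun z => ?_)
  by_cases hz : z ∈ Y
  · simp only [Set.indicator_of_mem hz]
    exact (sinkhornInner_eq_rescaledKernel ht x 0 z).symm
  · simp only [Set.indicator_of_notMem hz, mul_zero]

theorem setIntegral_sinkhornInner (hY : MeasurableSet Y) {t : ℝ} (ht : 0 < t)
    (x y : EuclideanSpace ℝ (Fin d)) :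
    ∫ z in Y, sinkhornInner g (t ^ 2) ψ x z = exp ((⟪x, y⟫ - ψ y) / t ^ 2) * t ^ d *
      rescaledNormalizer ψ (Y.indicator fun z => exp (-g z)) y t
        (t⁻¹ • (x - gradient ψ y)) := by
  rw [← integral_indicator hY, rescaledNormalizer, ← integral_const_mul]
  congr 1
  ext z
  by_cases hz : z ∈ Y
  · simp only [Set.indicator_of_mem hz]
    exact sinkhornInner_eq_rescaledKernel ht x y z
  · simp only [Set.indicator_of_notMem hz, mul_zero]

theorem sinkhornOuter_eq (hY : MeasurableSet Y) {t : ℝ} (ht : 0 < t)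
    (x y : EuclideanSpace ℝ (Fin d)) :
    sinkhornOuter Y f g (t ^ 2) ψ y x = exp (ψ y / t ^ 2) * ((t ^ d)⁻¹ *
      (rescaledNormalizer ψ (Y.indicator fun z => exp (-g z)) y t
        (t⁻¹ • (x - gradient ψ y)))⁻¹ * exp (-f x)) := by
  rw [sinkhornOuter, setIntegral_sinkhornInner hY ht x y]
  have h : exp (1 / t ^ 2 * ⟪x, y⟫) = exp (ψ y / t ^ 2) * exp ((⟪x, y⟫ - ψ y) / t ^ 2) := by
    rw [← exp_add]
    congr 1
    ring
  rw [h]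
  field_simp

theorem setIntegral_sinkhornOuter (hX : MeasurableSet X) (hY : MeasurableSet Y) {t : ℝ}
    (ht : 0 < t) (y : EuclideanSpace ℝ (Fin d)) :
    ∫ x in X, sinkhornOuter Y f g (t ^ 2) ψ y x = exp (ψ y / t ^ 2) * ∫ x, (t ^ d)⁻¹ *
      (rescaledNormalizer ψ (Y.indicator fun z => exp (-g z)) y t
        (t⁻¹ • (x - gradient ψ y)))⁻¹ * X.indicator (fun x => exp (-f x)) x := by
  rw [← integral_indicator hX, ← integral_const_mul]
  congr 1
  ext x
  by_cases hx : x ∈ X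
  · simp only [Set.indicator_of_mem hx]
    exact sinkhornOuter_eq hY ht x y
  · simp only [Set.indicator_of_notMem hx, mul_zero]

theorem rescaledNormalizer_pos (hψ : ContDiff ℝ 2 ψ) (hm : 0 < m)
    (hH : HessianBoundedBelow m ψ) {w : EuclideanSpace ℝ (Fin d) → ℝ} (hw : Integrable w)
    (hwy : ContinuousAt w y) (hw0 : ∀ z, 0 ≤ w z) (hwpos : 0 < w y) {t : ℝ} (ht : 0 < t)
    (u : EuclideanSpace ℝ (Fin d)) : 0 < rescaledNormalizer ψ w y t u := by
  obtain ⟨c, hc, M, hM, s₀, hs₀, h⟩ := exists_le_rescaledNormalizer hψ hm hH hw hwy hw0 hwpos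
  exact lt_of_lt_of_le (by positivity) (h s₀ hs₀ le_rfl t ht u)

theorem integrableOn_sinkhornOuter (hψ : ContDiff ℝ 2 ψ) (hm : 0 < m)
    (hH : HessianBoundedBelow m ψ) (hf : IsProbDensityOn X f) (hg : IsProbDensityOn Y g)
    (hy : y ∈ interior Y) (hgc : ContinuousAt g y) {t : ℝ} (ht : 0 < t) :
    IntegrableOn (sinkhornOuter Y f g (t ^ 2) ψ y) X := by
  set w := Y.indicator fun z => exp (-g z) with hw
  have hwy : w y = exp (-g y) := Set.indicator_of_mem (interior_subset hy) _
  have hw0 : ∀ z, 0 ≤ w z := fun z => Set.indicator_nonneg (fun _ _ => (exp_pos _).le) z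
  have hwpos : 0 < w y := hwy ▸ exp_pos _
  -- Taking `s = s₀` rather than `s = t` bounds the normalizer below uniformly in `u` for every `t`,
  -- not only for small `t`.
  obtain ⟨c, hc, M, hM, s₀, hs₀, h⟩ := exists_le_rescaledNormalizer hψ hm hH
    hg.integrable_indicator (continuousAt_indicator_exp_neg hy hgc) hw0 hwpos
  have hK : 0 < c * (s₀ / t) ^ d * exp (-(M * (s₀ / t) ^ 2)) := by positivity
  have hb : ∀ u, c * (s₀ / t) ^ d * exp (-(M * (s₀ / t) ^ 2)) ≤ rescaledNormalizer ψ w y t u := by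
    intro u
    refine le_trans ?_ (h s₀ hs₀ le_rfl t ht u)
    gcongr
    have : 0 ≤ s₀ / t * (‖u‖ / 2) := by positivity
    linarith
  have heq : sinkhornOuter Y f g (t ^ 2) ψ y = fun x => exp (ψ y / t ^ 2) * ((t ^ d)⁻¹ *
      (rescaledNormalizer ψ w y t (t⁻¹ • (x - gradient ψ y)))⁻¹ * exp (-f x)) :=
    funext fun x => sinkhornOuter_eq hg.measurableSet ht x y
  rw [heq]
  refine Integrable.const_mul ?_ _
  refine hf.integrableOn.bdd_mul
    (c := (t ^ d)⁻¹ * (c * (s₀ / t) ^ d * exp (-(M * (s₀ / t) ^ 2)))⁻¹) ?_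
    (ae_of_all _ fun x => ?_)
  · have hmeas : Measurable (rescaledNormalizer ψ w y t) :=
      measurable_rescaledNormalizer hψ.continuous hg.integrable_indicator t
    exact ((hmeas.comp (by fun_prop : Measurable fun x : EuclideanSpace ℝ (Fin d) =>
      t⁻¹ • (x - gradient ψ y))).inv.const_mul _).aestronglyMeasurable
  · have h1 := hb (t⁻¹ • (x - gradient ψ y))
    rw [norm_of_nonneg (mul_nonneg (by positivity) (inv_nonneg.2 (hK.le.trans h1)))]
    gcongr

theorem tendsto_integral_inv_rescaledNormalizer (hψ : ContDiff ℝ 2 ψ) (hm : 0 < m)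
    (hH : HessianBoundedBelow m ψ) {w w' : EuclideanSpace ℝ (Fin d) → ℝ} (hw : Integrable w)
    (hwy : ContinuousAt w y) (hw0 : ∀ z, 0 ≤ w z) (hwpos : 0 < w y) (hw' : Integrable w')
    (hwx : ContinuousAt w' x₀) :
    Tendsto (fun t : ℝ => ∫ x, (t ^ d)⁻¹ * (rescaledNormalizer ψ w y t (t⁻¹ • (x - x₀)))⁻¹ * w' x)
      (𝓝[>] 0) (𝓝 (w' x₀ * ((w y)⁻¹ * (hessian ψ y).det))) := by
  obtain ⟨c, hc, M, hM, s₀, hs₀, h⟩ := exists_le_rescaledNormalizer hψ hm hH hw hwy hw0 hwpos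
  obtain ⟨-, hpos, hint⟩ := integral_inv_gaussian_laplace (hessian_isSymmetric hψ y) hm (hH y)
  rw [← hint, ← integral_const_mul]
  refine tendsto_integral_rescaled_kernel hw' hwx
    (h := fun t u => (rescaledNormalizer ψ w y t u)⁻¹) (C := (c * exp (-M))⁻¹) hs₀
    (fun t _ _ => (measurable_rescaledNormalizer hψ.continuous hw t).inv)
    (fun t ht hts u => ?_) (fun u => ?_)
  -- With `s = t` all ratios `s / t` are `1`, leaving `c * exp (‖u‖ / 2 - M)`: exactly the decay
  -- needed for the reciprocal.
  · have h1 := h t ht hts t ht u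
    rw [div_self ht.ne', one_pow, mul_one, one_mul, one_pow, mul_one] at h1
    have h2 : 0 < c * exp (‖u‖ / 2 - M) := by positivity
    rw [abs_of_nonneg (inv_nonneg.2 (h2.le.trans h1))]
    refine (inv_anti₀ h2 h1).trans_eq ?_
    rw [exp_neg (‖u‖ / 2), ← mul_inv, mul_assoc, ← exp_add]
    ring_nf
  · simp_rw [← mul_inv]
    exact (tendsto_rescaledNormalizer hψ hm hH hw hwy u).inv₀ (mul_pos hwpos (hpos u)).ne'

theorem tendsto_sinkhornStep_sub_div (hψ : ContDiff ℝ 2 ψ) (hm : 0 < m)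
    (hH : HessianBoundedBelow m ψ) (hf : IsProbDensityOn X f) (hg : IsProbDensityOn Y g)
    (hyY : y ∈ interior Y) (hyX : gradient ψ y ∈ interior X)
    (hfc : ContinuousAt f (gradient ψ y)) (hgc : ContinuousAt g y)
    (hpos : ∀ ε : ℝ, 0 < ε → 0 < ∫ x in X, sinkhornOuter Y f g ε ψ y x) :
    Tendsto (fun ε : ℝ => (sinkhornStep X Y f g ε ψ y - ψ y) / ε) (𝓝[>] 0)
      (𝓝 (-f (gradient ψ y) + g y + log (hessian ψ y).det)) := by
  set w := Y.indicator fun z => exp (-g z) with hw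
  set w' := X.indicator fun x => exp (-f x) with hw'
  have hwy : w y = exp (-g y) := Set.indicator_of_mem (interior_subset hyY) _
  have hw'x : w' (gradient ψ y) = exp (-f (gradient ψ y)) :=
    Set.indicator_of_mem (interior_subset hyX) _
  have hdet := (integral_inv_gaussian_laplace (hessian_isSymmetric hψ y) hm (hH y)).1
  have hlim := tendsto_integral_inv_rescaledNormalizer (w := w) (w' := w') hψ hm hH
    hg.integrable_indicator (continuousAt_indicator_exp_neg hyY hgc)
    (fun z => Set.indicator_nonneg (fun _ _ => (exp_pos _).le) z) (hwy ▸ exp_pos _)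
    hf.integrable_indicator (continuousAt_indicator_exp_neg hyX hfc)
  rw [hwy, hw'x, ← exp_neg, neg_neg] at hlim
  have hlog := hlim.log (by positivity)
  rw [log_mul (exp_pos _).ne' (by positivity), log_mul (exp_pos _).ne' hdet.ne', log_exp, log_exp,
    ← add_assoc] at hlog
  have hsqrt : Tendsto Real.sqrt (𝓝[>] 0) (𝓝[>] 0) := by
    refine tendsto_nhdsWithin_iff.2 ⟨?_, ?_⟩
    · simpa using (continuous_sqrt.tendsto 0).mono_left nhdsWithin_le_nhds
    · filter_upwards [self_mem_nhdsWithin] with ε hε using sqrt_pos.2 hε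
  refine (hlog.comp hsqrt).congr' ?_
  filter_upwards [self_mem_nhdsWithin] with ε (hε : 0 < ε)
  have hp := hpos ε hε
  have ht : 0 < √ε := sqrt_pos.2 hε
  rw [sinkhornStep]
  rw [← sq_sqrt hε.le, setIntegral_sinkhornOuter hf.measurableSet hg.measurableSet ht] at hp ⊢
  rw [log_mul (exp_pos _).ne' (pos_of_mul_pos_right hp (exp_pos _).le).ne', log_exp,
    Function.comp, sqrt_sq ht.le]
  field_simp
  ring

end SinkhornStep

theorem mainTheorem8 {d : ℕ} (X Y : Set (EuclideanSpace ℝ (Fin d)))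
    (f g : EuclideanSpace ℝ (Fin d) → ℝ)
    (hf : IsProbDensityOn X f) (hg : IsProbDensityOn Y g)
    (ψ : EuclideanSpace ℝ (Fin d) → ℝ) (hψ : IsUniformlyStronglyConvexC2 ψ)
    (y : EuclideanSpace ℝ (Fin d))
    (hyY : y ∈ interior Y) (hyX : gradient ψ y ∈ interior X)
    (hfc : ContinuousAt f (gradient ψ y)) (hgc : ContinuousAt g y) :
    (∀ ε : ℝ, 0 < ε →
      (∀ x, IntegrableOn (sinkhornInner g ε ψ x) Y volume ∧
        0 < ∫ y' in Y, sinkhornInner g ε ψ x y') ∧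
      IntegrableOn (sinkhornOuter Y f g ε ψ y) X volume ∧
        0 < ∫ x in X, sinkhornOuter Y f g ε ψ y x) ∧
    Tendsto (fun ε : ℝ => (sinkhornStep X Y f g ε ψ y - ψ y) / ε) (𝓝[>] 0)
      (𝓝 (-f (gradient ψ y) + g y + log (hessian ψ y).det)) := by
  obtain ⟨hψ2, m, hm, hH⟩ := hψ
  have key : ∀ ε : ℝ, 0 < ε →
      (∀ x, IntegrableOn (sinkhornInner g ε ψ x) Y volume ∧
        0 < ∫ y' in Y, sinkhornInner g ε ψ x y') ∧
      IntegrableOn (sinkhornOuter Y f g ε ψ y) X volume ∧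
        0 < ∫ x in X, sinkhornOuter Y f g ε ψ y x := by
    intro ε hε
    have ht : 0 < √ε := sqrt_pos.2 hε
    have hwpos : 0 < Y.indicator (fun z => exp (-g z)) y := by
      rw [Set.indicator_of_mem (interior_subset hyY)]
      exact exp_pos _
    have hN := fun u => rescaledNormalizer_pos hψ2 hm hH hg.integrable_indicator
      (continuousAt_indicator_exp_neg hyY hgc)
      (fun z => Set.indicator_nonneg (fun _ _ => (exp_pos _).le) z) hwpos ht u
    have hO := integrableOn_sinkhornOuter hψ2 hm hH hf hg hyY hgc ht
    rw [← sq_sqrt hε.le]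
    refine ⟨fun x => ⟨integrableOn_sinkhornInner hψ2 hm hH hg ht x, ?_⟩, hO, ?_⟩
    · rw [setIntegral_sinkhornInner hg.measurableSet ht x y]
      have := hN ((√ε)⁻¹ • (x - gradient ψ y))
      positivity
    · have hOpos : ∀ x, 0 < sinkhornOuter Y f g (√ε ^ 2) ψ y x := fun x => by
        rw [sinkhornOuter_eq hg.measurableSet ht]
        have := hN ((√ε)⁻¹ • (x - gradient ψ y))
        positivity
      -- The integrand is positive everywhere, and `X` has positive measure as a neighbourhood of
      -- `∇ψ(y)`.
      rw [setIntegral_pos_iff_support_of_nonneg_ae (ae_of_all _ fun x => (hOpos x).le) hO,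
        Function.support_eq_univ fun x => (hOpos x).ne', Set.univ_inter]
      exact Measure.measure_pos_of_mem_nhds _ (mem_interior_iff_mem_nhds.1 hyX)
  exact ⟨key, tendsto_sinkhornStep_sub_div hψ2 hm hH hf hg hyY hyX hfc hgc
    fun ε hε => (key ε hε).2.2⟩
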